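/- Call $f\colon[0,\infty)\to\mathbb{R}$ a \emph{weak-KPP reaction} if $f\in C^{1}([0,\infty))$ with $f'$ (globally) $\gamma$-Hölder continuous on $[0,\infty)$ for some $\gamma\in(0,1]$, $f(0)=f(1)=0$, $f<0$ on $(1,\infty)$, $f'(1)<0$, $f>0$ on $(0,1)$, $f'(0)=f'(0^+)>0$, and $f(s)\le f'(0)\,s$ for all $s\in[0,1]$. For an open set $\Omega\subset\mathbb{R}$ and $V\colon\Omega\to\mathbb{R}$ define the generalized principal eigenvalue $$\lambda(-\partial_x^2-V,\Omega):=\sup\bigl\{\mu\in\mathbb{R} \;\bigm|\; \exists\,\psi\in W^{2,1}_{\mathrm{loc}}(\Omega),\ \psi>0 \text{ in }\Omega,\ \psi''+V\psi+\mu\psi\le 0 \text{ a.e. in }\Omega\bigr\}\in[-\infty,\infty].$$ There exist a weak-KPP reaction $f$ and a length $L>0$ such that $f'(0)>\pi^2/L^2$, the problem $$-u''=f(u)\ \text{ in }(0,L),\qquad u(0)=u(L)=0$$ has exactly one positive solution $\phi$ (among all $u\in C([0,L])\cap C^2((0,L))$ with $u>0$ in $(0,L)$), and $$\lambda\bigl(-\partial_x^2-f'(\phi),(0,L)\bigr)=0.$$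 -/

import Mathlib

open Set MeasureTheory
open scoped NNReal ContDiff

/-- A reaction `f : [0, ∞) → ℝ` (values of `f` at negative arguments are irrelevant): it is of class
`C^{1,γ}` on `[0, ∞)` for some `γ ∈ (0, 1]`, it vanishes at `0` and `1`, it is negative on
`(1, ∞)`, and `f'(1) < 0`. Derivatives are taken within `[0, ∞)`, so the one at `0` is the right
derivative. -/
structure IsReaction (f : ℝ → ℝ) : Prop where
  contDiffOn : ContDiffOn ℝ 1 f (Ici 0)
  holder : ∃ γ : ℝ≥0, 0 < γ ∧ γ ≤ 1 ∧
    ∃ C : ℝ≥0, HolderOnWith C γ (derivWithin f (Ici 0)) (Ici 0)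
  map_zero : f 0 = 0
  map_one : f 1 = 0
  neg_of_one_lt : ∀ s, 1 < s → f s < 0
  deriv_one_neg : derivWithin f (Ici 0) 1 < 0

/-- A positive reaction: `f > 0` on `(0, 1)` and `f'(0⁺) > 0`. -/
structure IsPositiveReaction (f : ℝ → ℝ) : Prop extends IsReaction f where
  pos : ∀ s ∈ Ioo (0 : ℝ) 1, 0 < f s
  deriv_zero_pos : 0 < derivWithin f (Ici 0) 0

/-- A weak-KPP reaction: a positive reaction with `f(s) ≤ f'(0) s` on `[0, 1]`. -/
structure IsWeakKPP (f : ℝ → ℝ) : Prop extends IsPositiveReaction f where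
  le_linear : ∀ s ∈ Icc (0 : ℝ) 1, f s ≤ derivWithin f (Ici 0) 0 * s

/-- `u` is a positive (classical) solution of `-u'' = f(u)` in `(0, L)`, `u(0) = u(L) = 0`. -/
structure IsPositiveSolution (f : ℝ → ℝ) (L : ℝ) (u : ℝ → ℝ) : Prop where
  continuousOn : ContinuousOn u (Icc 0 L)
  contDiffOn : ContDiffOn ℝ 2 u (Ioo 0 L)
  eqn : ∀ x ∈ Ioo 0 L, -deriv (deriv u) x = f (u x)
  left : u 0 = 0
  right : u L = 0
  pos : ∀ x ∈ Ioo 0 L, 0 < u x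

/-- `v` is a weak derivative of `u` on the open set `Ω ⊆ ℝ`; both are locally integrable there. -/
structure IsWeakDerivOn (Ω : Set ℝ) (u v : ℝ → ℝ) : Prop where
  locallyIntegrableOn : LocallyIntegrableOn u Ω
  locallyIntegrableOn_deriv : LocallyIntegrableOn v Ω
  integral_eq : ∀ η : ℝ → ℝ, ContDiff ℝ ∞ η → HasCompactSupport η → tsupport η ⊆ Ω →
    ∫ x in Ω, u x * deriv η x = -∫ x in Ω, v x * η x

/-- There is a positive `ψ ∈ W^{2,1}_loc(Ω)` with `ψ'' + V ψ + μ ψ ≤ 0` almost everywhere in `Ω`.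
As usual, `ψ` stands for the continuous representative of its class, and `ψ₁`, `ψ₂` are its weak
derivatives of order one and two. -/
def HasPositiveSupersolution (V : ℝ → ℝ) (Ω : Set ℝ) (μ : ℝ) : Prop :=
  ∃ ψ ψ₁ ψ₂ : ℝ → ℝ, ContinuousOn ψ Ω ∧ IsWeakDerivOn Ω ψ ψ₁ ∧ IsWeakDerivOn Ω ψ₁ ψ₂ ∧
    (∀ x ∈ Ω, 0 < ψ x) ∧
    ∀ᵐ x ∂(volume.restrict Ω), ψ₂ x + V x * ψ x + μ * ψ x ≤ 0

/-- The generalized principal eigenvalue `λ(-∂² - V, Ω)`, a supremum in `[-∞, ∞]`. -/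
noncomputable def principalEigenvalue (V : ℝ → ℝ) (Ω : Set ℝ) : EReal :=
  sSup ((fun μ : ℝ => (μ : EReal)) '' {μ : ℝ | HasPositiveSupersolution V Ω μ})

/-! The reaction is built backwards from its time map. Write the potential as `q ^ 2 / 2` and let `G
= displacement` be the inverse of `q`. A solution with `q = M` at its maximum satisfies `q(u) = M
sin θ` and `dx = G'(M sin θ) dθ`, so it needs the time `T(M) = ∫₀^{π/2} G'(M sin θ) dθ` to rise from
zero to its maximum. The polynomial `G` gives `T(M) = π/2 * (11/20 + 7/20 * (M² - 1)³)`: strictly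
increasing for `M > 0`, but with `T'(1) = 0`. With `L = 2 T(1)`, monotonicity yields uniqueness,
while the critical point makes the solution with `M = 1` degenerate: the `M`-derivative of the
family is a positive Dirichlet solution `w` of the linearized equation.

Since `G(1) = 1/2`, this solution only sees values in `[0, 1/2]`. The reaction is cut down beyond
`1/2` to vanish at `1`; this lowers it, hence only slows down solutions with `M > 1`, and uniqueness
survives (`IsPositiveSolution.comparisonTime_eq`).

The function `w` is a supersolution for `μ = 0`, so the eigenvalue is at least `0`. For `μ > 0`, a
smooth compactly supported truncation of `w` is a nonnegative strict subsolution wherever it is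
positive; testing a supersolution against it gives a contradiction (`truncation_pos`,
`not_hasPositiveSupersolution`). -/

theorem exists_inverse_of_deriv_ge {g g' : ℝ → ℝ} {c : ℝ} (hc : 0 < c)
    (hg : ∀ x, HasDerivAt g (g' x) x) (hg' : ∀ x, c ≤ g' x) :
    ∃ h : ℝ → ℝ, (∀ x, h (g x) = x) ∧ (∀ y, g (h y) = y) ∧ StrictMono h ∧
      ∀ y, HasDerivAt h (g' (h y))⁻¹ y := by
  have hmono : StrictMono g := strictMono_of_deriv_pos fun x => by
    rw [(hg x).deriv]; exact hc.trans_le (hg' x)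
  have hcont : Continuous g := continuous_iff_continuousAt.2 fun x => (hg x).continuousAt
  have hlin : Monotone fun x => g x - c * x := by
    refine monotone_of_deriv_nonneg (fun x => ((hg x).sub ((hasDerivAt_id x).const_mul c)).differentiableAt) fun x => ?_
    have := ((hg x).sub ((hasDerivAt_id x).const_mul c)).deriv
    simp only [id] at this
    change 0 ≤ deriv (g - fun x => c * x) x
    rw [this]; linarith [hg' x]
  have htop : Filter.Tendsto g Filter.atTop Filter.atTop := by
    refine Filter.tendsto_atTop_mono' _ (f₁ := fun x => c * x + g 0) ?_
      (Filter.tendsto_atTop_add_const_right _ _ (Filter.tendsto_id.const_mul_atTop hc))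
    filter_upwards [Filter.eventually_ge_atTop 0] with x hx
    have := hlin hx
    simp only [mul_zero, sub_zero] at this
    linarith
  have hbot : Filter.Tendsto g Filter.atBot Filter.atBot := by
    refine Filter.tendsto_atBot_mono' _ (f₁ := fun x => c * x + g 0) ?_
      (Filter.tendsto_atBot_add_const_right _ _ (Filter.tendsto_id.const_mul_atBot hc))
    filter_upwards [Filter.eventually_le_atBot 0] with x hx
    have := hlin hx
    simp only [mul_zero, sub_zero] at this
    linarith
  let e : ℝ ≃o ℝ := hmono.orderIsoOfSurjective g (hcont.surjective htop hbot)
  have he : ∀ x, g (e.symm x) = x := fun x => e.apply_symm_apply x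
  refine ⟨e.symm, fun x => e.symm_apply_apply x, he, e.symm.strictMono, fun y => ?_⟩
  exact HasDerivAt.of_local_left_inverse e.symm.continuous.continuousAt (hg _)
    (hc.trans_le (hg' _)).ne' (Filter.Eventually.of_forall he)

/-! ### The polynomial `displacement` and its inverse. -/

/-- The displacement as a function of the square root of twice the potential energy. -/
noncomputable def displacement (p : ℝ) : ℝ :=
  p / 5 + 7 / 10 * p ^ 3 - 14 / 25 * p ^ 5 + 4 / 25 * p ^ 7

/-- The derivative of `displacement`. -/
noncomputable def displacement₁ (p : ℝ) : ℝ :=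
  1 / 5 + 21 / 10 * p ^ 2 - 14 / 5 * p ^ 4 + 28 / 25 * p ^ 6

/-- The second derivative of `displacement`. -/
noncomputable def displacement₂ (p : ℝ) : ℝ :=
  21 / 5 * p - 56 / 5 * p ^ 3 + 168 / 25 * p ^ 5

theorem hasDerivAt_displacement (p : ℝ) : HasDerivAt displacement (displacement₁ p) p := by
  have := ((((hasDerivAt_id p).div_const 5).add ((hasDerivAt_pow 3 p).const_mul (7 / 10))).sub
    ((hasDerivAt_pow 5 p).const_mul (14 / 25))).add ((hasDerivAt_pow 7 p).const_mul (4 / 25))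
  refine this.congr_deriv ?_
  norm_num [displacement₁]; ring

theorem hasDerivAt_displacement₁ (p : ℝ) : HasDerivAt displacement₁ (displacement₂ p) p := by
  have := ((((hasDerivAt_pow 2 p).const_mul (21 / 10)).const_add (1 / 5)).sub
    ((hasDerivAt_pow 4 p).const_mul (14 / 5))).add ((hasDerivAt_pow 6 p).const_mul (28 / 25))
  refine this.congr_deriv ?_
  norm_num [displacement₂]; ring

/-- Completing the square in `p ^ 2`; the uniform bound makes `displacement` invertible on all of
`ℝ`. -/
theorem le_displacement₁ (p : ℝ) : 1 / 5 ≤ displacement₁ p := by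
  have h : displacement₁ p =
      1 / 5 + p ^ 2 * (28 / 25 * (p ^ 2 - 5 / 4) ^ 2 + 7 / 20) := by
    unfold displacement₁; ring
  rw [h]; have : 0 ≤ p ^ 2 * (28 / 25 * (p ^ 2 - 5 / 4) ^ 2 + 7 / 20) := by positivity
  linarith

theorem displacement₁_pos (p : ℝ) : 0 < displacement₁ p := by
  linarith [le_displacement₁ p]

theorem displacement_strictMono : StrictMono displacement :=
  strictMono_of_deriv_pos fun p => by
    rw [(hasDerivAt_displacement p).deriv]; exact displacement₁_pos p

@[simp] theorem displacement_zero : displacement 0 = 0 := by norm_num [displacement]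

@[simp] theorem displacement_one : displacement 1 = 1 / 2 := by norm_num [displacement]

theorem le_displacement {p : ℝ} (hp : 0 ≤ p) : p / 5 ≤ displacement p := by
  have h : displacement p =
      p / 5 + p ^ 3 * (4 / 25 * (p ^ 2 - 7 / 4) ^ 2 + 21 / 100) := by
    unfold displacement; ring
  rw [h]
  have : 0 ≤ p ^ 3 * (4 / 25 * (p ^ 2 - 7 / 4) ^ 2 + 21 / 100) := by positivity
  linarith

/-- The inverse of `displacement`. -/
noncomputable def rootEnergy : ℝ → ℝ :=
  Classical.choose (exists_inverse_of_deriv_ge (by norm_num) hasDerivAt_displacement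
    le_displacement₁)

@[simp] theorem rootEnergy_displacement (p : ℝ) : rootEnergy (displacement p) = p :=
  (Classical.choose_spec (exists_inverse_of_deriv_ge (by norm_num) hasDerivAt_displacement
    le_displacement₁)).1 p

@[simp] theorem displacement_rootEnergy (s : ℝ) : displacement (rootEnergy s) = s :=
  (Classical.choose_spec (exists_inverse_of_deriv_ge (by norm_num) hasDerivAt_displacement
    le_displacement₁)).2.1 s

theorem rootEnergy_strictMono : StrictMono rootEnergy :=
  (Classical.choose_spec (exists_inverse_of_deriv_ge (by norm_num) hasDerivAt_displacement
    le_displacement₁)).2.2.1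

theorem hasDerivAt_rootEnergy (s : ℝ) :
    HasDerivAt rootEnergy (displacement₁ (rootEnergy s))⁻¹ s :=
  (Classical.choose_spec (exists_inverse_of_deriv_ge (by norm_num) hasDerivAt_displacement
    le_displacement₁)).2.2.2 s

theorem continuous_rootEnergy : Continuous rootEnergy :=
  continuous_iff_continuousAt.2 fun s => (hasDerivAt_rootEnergy s).continuousAt

@[simp] theorem rootEnergy_zero : rootEnergy 0 = 0 := by
  simpa using rootEnergy_displacement 0

@[simp] theorem rootEnergy_half : rootEnergy (1 / 2) = 1 := by
  simpa using rootEnergy_displacement 1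

theorem rootEnergy_nonneg {s : ℝ} (hs : 0 ≤ s) : 0 ≤ rootEnergy s := by
  simpa using rootEnergy_strictMono.monotone hs

theorem rootEnergy_pos {s : ℝ} (hs : 0 < s) : 0 < rootEnergy s := by
  simpa using rootEnergy_strictMono hs

/-! ### The reaction, its cutoff and the weak-KPP conditions. -/

/-- The reaction whose potential is `rootEnergy ^ 2 / 2`. -/
noncomputable def baseReaction (s : ℝ) : ℝ := rootEnergy s / displacement₁ (rootEnergy s)

/-- The derivative of `baseReaction`, as a function of `rootEnergy`. -/
noncomputable def baseSlope (p : ℝ) : ℝ :=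
  (displacement₁ p - p * displacement₂ p) / displacement₁ p ^ 3

theorem hasDerivAt_baseReaction (s : ℝ) :
    HasDerivAt baseReaction (baseSlope (rootEnergy s)) s := by
  have hq := hasDerivAt_rootEnergy s
  have h0 := (displacement₁_pos (rootEnergy s)).ne'
  have := hq.div ((hasDerivAt_displacement₁ _).comp s hq) h0
  refine this.congr_deriv ?_
  simp only [baseSlope, Function.comp]
  field_simp

theorem baseReaction_nonneg {s : ℝ} (hs : 0 ≤ s) : 0 ≤ baseReaction s :=
  div_nonneg (rootEnergy_nonneg hs) (displacement₁_pos _).le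

theorem baseReaction_pos {s : ℝ} (hs : 0 < s) : 0 < baseReaction s :=
  div_pos (rootEnergy_pos hs) (displacement₁_pos _)

theorem baseReaction_le {s : ℝ} (hs : 0 ≤ s) : baseReaction s ≤ 25 * s := by
  have h1 := le_displacement (rootEnergy_nonneg hs)
  rw [displacement_rootEnergy] at h1
  rw [baseReaction, div_le_iff₀ (displacement₁_pos _)]
  nlinarith [le_displacement₁ (rootEnergy s)]

theorem hasDerivAt_sq_max_sub (a s : ℝ) :
    HasDerivAt (fun s => max (s - a) 0 ^ 2) (2 * max (s - a) 0) s := by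
  rcases lt_trichotomy s a with h | rfl | h
  · rw [max_eq_right (by linarith), mul_zero]
    refine (hasDerivAt_const s (0 : ℝ)).congr_of_eventuallyEq ?_
    filter_upwards [gt_mem_nhds h] with x hx
    rw [max_eq_right (by linarith)]; norm_num
  · rw [sub_self, max_self, mul_zero, hasDerivAt_iff_isLittleO]
    simp only [sub_self, max_self, smul_zero, sub_zero]
    have h1 : (fun x : ℝ => max (x - s) 0 ^ 2) =O[nhds s] fun x => (x - s) ^ 2 := by
      refine Asymptotics.isBigO_of_le _ fun x => ?_
      rw [norm_pow, norm_pow]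
      gcongr
      rw [Real.norm_eq_abs, Real.norm_eq_abs, abs_of_nonneg (le_max_right _ _)]
      exact max_le (le_abs_self _) (abs_nonneg _)
    have h2 : (fun x : ℝ => (x - s) ^ 2) =o[nhds s] fun x => x - s := by
      have : Filter.Tendsto (fun x : ℝ => x - s) (nhds s) (nhds 0) := by
        have : Continuous fun x : ℝ => x - s := by fun_prop
        simpa using this.tendsto s
      exact (Asymptotics.isLittleO_pow_id one_lt_two).comp_tendsto this
    simpa using h1.trans_isLittleO h2
  · rw [max_eq_left (by linarith)]
    have : HasDerivAt (fun s => (s - a) ^ 2) (2 * (s - a)) s := by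
      simpa [Pi.pow_def] using ((hasDerivAt_id s).sub_const a).pow 2
    refine this.congr_of_eventuallyEq ?_
    filter_upwards [lt_mem_nhds h] with x hx
    rw [max_eq_left (by linarith)]

/-- The derivative of `baseReaction * (1 - 4 * max (s - 1 / 2) 0 ^ 2)` in terms of
`p = rootEnergy s` and `t = max (s - 1 / 2) 0`. -/
noncomputable def cutSlope (z : ℝ × ℝ) : ℝ :=
  baseSlope z.1 * (1 - 4 * z.2 ^ 2) - 8 * z.2 * (z.1 / displacement₁ z.1)

theorem contDiff_cutSlope : ContDiff ℝ 1 cutSlope := by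
  have h1 : ContDiff ℝ 1 fun z : ℝ × ℝ => displacement₁ z.1 := by
    unfold displacement₁; fun_prop
  have h2 : ContDiff ℝ 1 fun z : ℝ × ℝ => displacement₂ z.1 := by
    unfold displacement₂; fun_prop
  have h3 : ContDiff ℝ 1 fun z : ℝ × ℝ => (displacement₁ z.1)⁻¹ :=
    h1.inv fun z => (displacement₁_pos _).ne'
  have : cutSlope = fun z : ℝ × ℝ =>
      (displacement₁ z.1 - z.1 * displacement₂ z.1) * (displacement₁ z.1)⁻¹ ^ 3 *
        (1 - 4 * z.2 ^ 2) - 8 * z.2 * (z.1 * (displacement₁ z.1)⁻¹) := by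
    funext z; simp only [cutSlope, baseSlope, div_eq_mul_inv, inv_pow]
  rw [this]; fun_prop

/-- The derivative of `reaction`. -/
noncomputable def reactionSlope (s : ℝ) : ℝ :=
  cutSlope (rootEnergy (min s 1), max (min s 1 - 1 / 2) 0)

theorem continuous_reactionSlope : Continuous reactionSlope := by
  unfold reactionSlope
  exact contDiff_cutSlope.continuous.comp
    ((continuous_rootEnergy.comp (by fun_prop)).prodMk (by fun_prop))

theorem lipschitzWith_rootEnergy : LipschitzWith 5 rootEnergy := by
  refine lipschitzWith_of_nnnorm_deriv_le
    (fun s => (hasDerivAt_rootEnergy s).differentiableAt) fun s => ?_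
  rw [(hasDerivAt_rootEnergy s).deriv, ← NNReal.coe_le_coe, coe_nnnorm, Real.norm_eq_abs,
    abs_of_pos (inv_pos.2 (displacement₁_pos _))]
  exact inv_le_of_inv_le₀ (by norm_num) (by simpa using le_displacement₁ (rootEnergy s))

/-- A `C¹` function is composed with a Lipschitz map that sends `[0, ∞)` into a compact rectangle,
thanks to the truncation `min s 1`. -/
theorem exists_lipschitzOnWith_reactionSlope : ∃ C, LipschitzOnWith C reactionSlope (Ici 0) := by
  have hcomp : IsCompact (Icc (0 : ℝ) (rootEnergy 1) ×ˢ Icc (0 : ℝ) 1) :=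
    isCompact_Icc.prod isCompact_Icc
  obtain ⟨C, hC⟩ := (contDiff_cutSlope.locallyLipschitz.locallyLipschitzOn
    (s := Icc (0 : ℝ) (rootEnergy 1) ×ˢ Icc (0 : ℝ) 1)).exists_lipschitzOnWith_of_compact hcomp
  have h1 : LipschitzWith 1 fun s : ℝ => min s 1 := LipschitzWith.id.min_const 1
  have h2 : LipschitzWith (1 + 0) fun s : ℝ => min s 1 - 1 / 2 :=
    h1.sub (LipschitzWith.const _)
  have h3 := (lipschitzWith_rootEnergy.comp h1).prodMk (h2.max_const 0)
  refine ⟨_, hC.comp h3.lipschitzOnWith fun s hs => ?_⟩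
  have hs : (0 : ℝ) ≤ s := hs
  have hm : 0 ≤ min s 1 := le_min hs zero_le_one
  exact ⟨⟨rootEnergy_nonneg hm, rootEnergy_strictMono.monotone (min_le_right _ _)⟩,
    le_max_right _ _, max_le (by linarith [min_le_right s 1]) zero_le_one⟩

/-- The reaction: `baseReaction` on `[0, 1 / 2]`, cut off on `[1 / 2, 1]`, linear on `[1, ∞)`. -/
noncomputable def reaction (s : ℝ) : ℝ := ∫ t in (0 : ℝ)..s, reactionSlope t

theorem hasDerivAt_reaction (s : ℝ) : HasDerivAt reaction (reactionSlope s) s :=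
  intervalIntegral.integral_hasDerivAt_right (continuous_reactionSlope.intervalIntegrable _ _)
    (continuous_reactionSlope.stronglyMeasurableAtFilter _ _) continuous_reactionSlope.continuousAt

theorem continuous_reaction : Continuous reaction :=
  continuous_iff_continuousAt.2 fun s => (hasDerivAt_reaction s).continuousAt

theorem reactionSlope_of_le_one {s : ℝ} (hs : s ≤ 1) :
    reactionSlope s = cutSlope (rootEnergy s, max (s - 1 / 2) 0) := by
  rw [reactionSlope, min_eq_left hs]

theorem reaction_eq {s : ℝ} (hs : s ∈ Icc (0 : ℝ) 1) :
    reaction s = baseReaction s * (1 - 4 * max (s - 1 / 2) 0 ^ 2) := by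
  have h : ∀ x ∈ uIcc 0 s, HasDerivAt
      (fun s => baseReaction s * (1 - 4 * max (s - 1 / 2) 0 ^ 2)) (reactionSlope x) x := by
    intro x hx
    rw [uIcc_of_le hs.1] at hx
    have := (hasDerivAt_baseReaction x).mul
      (((hasDerivAt_sq_max_sub (1 / 2) x).const_mul 4).const_sub 1)
    refine this.congr_deriv ?_
    rw [reactionSlope_of_le_one (hx.2.trans hs.2)]
    simp only [cutSlope, baseReaction]; ring
  have := intervalIntegral.integral_eq_sub_of_hasDerivAt h
    (continuous_reactionSlope.intervalIntegrable _ _)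
  rw [reaction, this]; simp [baseReaction]

theorem reaction_eq_baseReaction {s : ℝ} (hs : s ∈ Icc (0 : ℝ) (1 / 2)) :
    reaction s = baseReaction s := by
  rw [reaction_eq ⟨hs.1, by linarith [hs.2]⟩, max_eq_right (by linarith [hs.2])]; ring

theorem reactionSlope_eq_baseSlope {s : ℝ} (hs : s ≤ 1 / 2) :
    reactionSlope s = baseSlope (rootEnergy s) := by
  rw [reactionSlope_of_le_one (by linarith), max_eq_right (by linarith)]
  simp [cutSlope]

theorem reactionSlope_of_one_le {s : ℝ} (hs : 1 ≤ s) : reactionSlope s = -4 * baseReaction 1 := by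
  rw [reactionSlope, min_eq_right hs, max_eq_left (by norm_num)]
  simp only [cutSlope, baseReaction]; norm_num

theorem reaction_one : reaction 1 = 0 := by
  rw [reaction_eq (by simp), max_eq_left (by norm_num)]; norm_num

theorem reaction_of_one_le {s : ℝ} (hs : 1 ≤ s) :
    reaction s = -4 * baseReaction 1 * (s - 1) := by
  have h1 : reaction s - reaction 1 = ∫ t in (1 : ℝ)..s, reactionSlope t :=
    intervalIntegral.integral_interval_sub_left (continuous_reactionSlope.intervalIntegrable _ _)
      (continuous_reactionSlope.intervalIntegrable _ _)
  have h2 : ∫ t in (1 : ℝ)..s, reactionSlope t = ∫ _ in (1 : ℝ)..s, -4 * baseReaction 1 :=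
    intervalIntegral.integral_congr fun t ht => by
      rw [uIcc_of_le hs] at ht; exact reactionSlope_of_one_le ht.1
  rw [h2, intervalIntegral.integral_const, reaction_one, smul_eq_mul] at h1
  linarith

theorem reaction_le_baseReaction {s : ℝ} (hs : 0 ≤ s) : reaction s ≤ baseReaction s := by
  rcases le_total s 1 with h | h
  · rw [reaction_eq ⟨hs, h⟩]
    nlinarith [baseReaction_nonneg hs, sq_nonneg (max (s - 1 / 2) 0)]
  · rw [reaction_of_one_le h]
    nlinarith [baseReaction_nonneg hs, baseReaction_nonneg zero_le_one]

theorem derivWithin_reaction {s : ℝ} (hs : 0 ≤ s) :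
    derivWithin reaction (Ici 0) s = reactionSlope s :=
  (hasDerivAt_reaction s).hasDerivWithinAt.derivWithin (uniqueDiffOn_Ici 0 s hs)

theorem derivWithin_reaction_zero : derivWithin reaction (Ici 0) 0 = 25 := by
  rw [derivWithin_reaction le_rfl, reactionSlope_eq_baseSlope (by norm_num)]
  norm_num [baseSlope, displacement₁]

theorem isWeakKPP_reaction : IsWeakKPP reaction where
  contDiffOn := by
    refine ContDiff.contDiffOn (contDiff_one_iff_deriv.2
      ⟨fun s => (hasDerivAt_reaction s).differentiableAt, ?_⟩)
    rw [show deriv reaction = reactionSlope from funext fun s => (hasDerivAt_reaction s).deriv]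
    exact continuous_reactionSlope
  holder := by
    obtain ⟨C, hC⟩ := exists_lipschitzOnWith_reactionSlope
    refine ⟨1, one_pos, le_rfl, C, ?_⟩
    refine holderOnWith_one.2 fun x hx y hy => ?_
    rw [derivWithin_reaction hx, derivWithin_reaction hy]
    exact hC hx hy
  map_zero := by simp [reaction]
  map_one := reaction_one
  neg_of_one_lt s hs := by
    rw [reaction_of_one_le hs.le]
    nlinarith [baseReaction_pos one_pos, mul_pos (baseReaction_pos one_pos) (sub_pos.2 hs)]
  deriv_one_neg := by
    rw [derivWithin_reaction zero_le_one, reactionSlope_of_one_le le_rfl]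
    linarith [baseReaction_pos one_pos]
  pos s hs := by
    rw [reaction_eq ⟨hs.1.le, hs.2.le⟩]
    refine mul_pos (baseReaction_pos hs.1) ?_
    have h1 : max (s - 1 / 2) 0 < 1 / 2 := max_lt (by linarith [hs.2]) (by norm_num)
    nlinarith [le_max_right (s - 1 / 2) 0]
  deriv_zero_pos := by rw [derivWithin_reaction_zero]; norm_num
  le_linear s hs := by
    rw [derivWithin_reaction_zero]
    exact (reaction_le_baseReaction hs.1).trans (baseReaction_le hs.1)

/-! ### The time map and the positive solution. -/

/-- The integral of `displacement₁ (M * sin t)` over `t ∈ [0, θ]`. -/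
noncomputable def travelTime (M θ : ℝ) : ℝ :=
  θ / 5 + 21 / 20 * M ^ 2 * (θ - Real.sin θ * Real.cos θ) -
    14 / 5 * M ^ 4 * (3 / 8 * θ - 3 / 8 * Real.sin θ * Real.cos θ
      - 1 / 4 * Real.sin θ ^ 3 * Real.cos θ) +
    28 / 25 * M ^ 6 * (5 / 16 * θ - 5 / 16 * Real.sin θ * Real.cos θ
      - 5 / 24 * Real.sin θ ^ 3 * Real.cos θ - 1 / 6 * Real.sin θ ^ 5 * Real.cos θ)

theorem hasDerivAt_travelTime (M θ : ℝ) :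
    HasDerivAt (travelTime M) (displacement₁ (M * Real.sin θ)) θ := by
  have hs := Real.hasDerivAt_sin θ
  have hc := Real.hasDerivAt_cos θ
  have hi := hasDerivAt_id θ
  have := (((hi.div_const 5).add ((hi.sub (hs.mul hc)).const_mul (21 / 20 * M ^ 2))).sub
    ((((hi.const_mul (3 / 8)).sub ((hs.const_mul (3 / 8)).mul hc)).sub
      (((hs.pow 3).const_mul (1 / 4)).mul hc)).const_mul (14 / 5 * M ^ 4))).add
    (((((hi.const_mul (5 / 16)).sub ((hs.const_mul (5 / 16)).mul hc)).sub
      (((hs.pow 3).const_mul (5 / 24)).mul hc)).sub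
      (((hs.pow 5).const_mul (1 / 6)).mul hc)).const_mul (28 / 25 * M ^ 6))
  refine this.congr_deriv ?_
  have h2 : Real.cos θ * Real.cos θ = 1 - Real.sin θ ^ 2 := by
    rw [← Real.cos_sq']; ring
  simp only [displacement₁, Pi.pow_apply]
  norm_num
  -- Differentiating the reduction formulas for the integrals of even powers of the sine leaves
  -- products with `cos²`, which are turned into powers of the sine.
  have e3 : Real.sin θ ^ 2 * Real.cos θ * Real.cos θ
      = Real.sin θ ^ 2 * (1 - Real.sin θ ^ 2) := by rw [← h2]; ring
  have e5 : Real.sin θ ^ 4 * Real.cos θ * Real.cos θ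
      = Real.sin θ ^ 4 * (1 - Real.sin θ ^ 2) := by rw [← h2]; ring
  linear_combination (-21 / 20 * M ^ 2 + 14 / 5 * M ^ 4 * (3 / 8) - 28 / 25 * M ^ 6 * (5 / 16)) * h2
    + (14 / 5 * M ^ 4 * (3 / 4) - 28 / 25 * M ^ 6 * (5 / 8)) * e3 - 28 / 25 * M ^ 6 * (5 / 6) * e5

@[simp] theorem travelTime_zero (M : ℝ) : travelTime M 0 = 0 := by simp [travelTime]

/-- The means of `sin²`, `sin⁴`, `sin⁶` are `1/2`, `3/8`, `5/16`; the coefficients of `displacement`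
are tuned to them so that a perfect cube appears, with its inflection at `M = 1`. -/
theorem travelTime_pi_div_two (M : ℝ) :
    travelTime M (Real.pi / 2) = Real.pi / 2 * (11 / 20 + 7 / 20 * (M ^ 2 - 1) ^ 3) := by
  simp only [travelTime, Real.cos_pi_div_two]; ring

theorem travelTime_one_pi : travelTime 1 Real.pi = 11 / 20 * Real.pi := by
  simp only [travelTime, Real.sin_pi]; ring

theorem travelTime_strictMono (M : ℝ) : StrictMono (travelTime M) :=
  strictMono_of_deriv_pos fun θ => by
    rw [(hasDerivAt_travelTime M θ).deriv]; exact displacement₁_pos _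

/-- The inverse of `travelTime 1`. -/
noncomputable def angle : ℝ → ℝ :=
  Classical.choose (exists_inverse_of_deriv_ge (by norm_num) (hasDerivAt_travelTime 1)
    fun _ => le_displacement₁ _)

theorem angle_travelTime (θ : ℝ) : angle (travelTime 1 θ) = θ :=
  (Classical.choose_spec (exists_inverse_of_deriv_ge (by norm_num) (hasDerivAt_travelTime 1)
    fun _ => le_displacement₁ _)).1 θ

theorem angle_strictMono : StrictMono angle :=
  (Classical.choose_spec (exists_inverse_of_deriv_ge (by norm_num) (hasDerivAt_travelTime 1)
    fun _ => le_displacement₁ _)).2.2.1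

theorem hasDerivAt_angle (x : ℝ) :
    HasDerivAt angle (displacement₁ (Real.sin (angle x)))⁻¹ x := by
  have := (Classical.choose_spec (exists_inverse_of_deriv_ge (by norm_num)
    (hasDerivAt_travelTime 1) fun _ => le_displacement₁ _)).2.2.2 x
  rw [one_mul] at this
  exact this

@[simp] theorem angle_zero : angle 0 = 0 := by simpa using angle_travelTime 0

theorem angle_end : angle (11 / 20 * Real.pi) = Real.pi := by
  rw [← travelTime_one_pi, angle_travelTime]

theorem contDiff_displacement {n : ℕ∞ω} : ContDiff ℝ n displacement := by
  unfold displacement; fun_prop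

theorem contDiff_displacement₁ {n : ℕ∞ω} : ContDiff ℝ n displacement₁ := by
  unfold displacement₁; fun_prop

/-- Bootstrap: the derivative of `angle` is a smooth function of `angle`. -/
theorem contDiff_angle : ContDiff ℝ ∞ angle := by
  refine contDiff_infty.2 fun n => ?_
  induction n with
  | zero =>
    exact contDiff_zero.2 (continuous_iff_continuousAt.2 fun x => (hasDerivAt_angle x).continuousAt)
  | succ n ih =>
    rw [Nat.cast_succ, contDiff_succ_iff_deriv]
    refine ⟨fun x => (hasDerivAt_angle x).differentiableAt, by simp, ?_⟩
    rw [show deriv angle = fun x => (displacement₁ (Real.sin (angle x)))⁻¹ from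
      funext fun x => (hasDerivAt_angle x).deriv]
    exact (contDiff_displacement₁.comp (Real.contDiff_sin.comp ih)).inv
      fun x => (displacement₁_pos _).ne'

theorem angle_mem_Ioo {x : ℝ} (hx : x ∈ Ioo 0 (11 / 20 * Real.pi)) :
    angle x ∈ Ioo 0 Real.pi := by
  have h1 := angle_strictMono hx.1
  have h2 := angle_strictMono hx.2
  rw [angle_zero] at h1
  rw [angle_end] at h2
  exact ⟨h1, h2⟩

theorem sin_angle_pos {x : ℝ} (hx : x ∈ Ioo 0 (11 / 20 * Real.pi)) : 0 < Real.sin (angle x) :=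
  Real.sin_pos_of_mem_Ioo (angle_mem_Ioo hx)

/-- The positive solution. -/
noncomputable def profile (x : ℝ) : ℝ := displacement (Real.sin (angle x))

theorem hasDerivAt_sin_angle (x : ℝ) : HasDerivAt (fun x => Real.sin (angle x))
    (Real.cos (angle x) / displacement₁ (Real.sin (angle x))) x :=
  (hasDerivAt_angle x).sin

theorem hasDerivAt_profile (x : ℝ) : HasDerivAt profile (Real.cos (angle x)) x := by
  refine ((hasDerivAt_displacement _).comp x (hasDerivAt_sin_angle x)).congr_deriv ?_
  have := (displacement₁_pos (Real.sin (angle x))).ne'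
  field_simp

theorem profile_mem {x : ℝ} (hx : x ∈ Ioo 0 (11 / 20 * Real.pi)) :
    profile x ∈ Ioc (0 : ℝ) (1 / 2) := by
  constructor
  · simpa [profile] using displacement_strictMono (sin_angle_pos hx)
  · simpa [profile] using displacement_strictMono.monotone (Real.sin_le_one (angle x))

theorem isPositiveSolution_profile :
    IsPositiveSolution reaction (11 / 20 * Real.pi) profile where
  continuousOn := (continuous_iff_continuousAt.2
    fun x => (hasDerivAt_profile x).continuousAt).continuousOn
  contDiffOn := ((contDiff_displacement.comp (Real.contDiff_sin.comp contDiff_angle)).of_le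
    (WithTop.coe_le_coe.2 le_top)).contDiffOn
  eqn x hx := by
    rw [show deriv profile = fun x => Real.cos (angle x) from
      funext fun x => (hasDerivAt_profile x).deriv, (hasDerivAt_angle x).cos.deriv,
      reaction_eq_baseReaction ⟨(profile_mem hx).1.le, (profile_mem hx).2⟩, baseReaction, profile,
      rootEnergy_displacement]
    ring
  left := by simp [profile]
  right := by simp [profile, angle_end]
  pos x hx := (profile_mem hx).1

theorem derivWithin_reaction_profile {x : ℝ} (hx : x ∈ Ioo 0 (11 / 20 * Real.pi)) :
    derivWithin reaction (Ici 0) (profile x) = baseSlope (Real.sin (angle x)) := by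
  rw [derivWithin_reaction (profile_mem hx).1.le, reactionSlope_eq_baseSlope (profile_mem hx).2,
    profile, rootEnergy_displacement]

/-! ### The kernel of the linearization. -/

/-- The solution of the linearized equation, as a function of `sin (angle x)`. -/
noncomputable def kernelPoly (s : ℝ) : ℝ := s / 5 + 7 / 10 * s ^ 3 - 7 / 25 * s ^ 5

/-- The derivative of `kernelPoly`. -/
noncomputable def kernelPoly₁ (s : ℝ) : ℝ := 1 / 5 + 21 / 10 * s ^ 2 - 7 / 5 * s ^ 4

theorem hasDerivAt_kernelPoly (s : ℝ) : HasDerivAt kernelPoly (kernelPoly₁ s) s := by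
  have := (((hasDerivAt_id s).div_const 5).add ((hasDerivAt_pow 3 s).const_mul (7 / 10))).sub
    ((hasDerivAt_pow 5 s).const_mul (7 / 25))
  refine this.congr_deriv ?_
  norm_num [kernelPoly₁]; ring

theorem hasDerivAt_kernelPoly₁ (s : ℝ) :
    HasDerivAt kernelPoly₁ (21 / 5 * s - 28 / 5 * s ^ 3) s := by
  have := (((hasDerivAt_pow 2 s).const_mul (21 / 10)).const_add (1 / 5)).sub
    ((hasDerivAt_pow 4 s).const_mul (7 / 5))
  refine this.congr_deriv ?_
  norm_num; ring

/-- A positive solution of the linearized equation around `profile`. -/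
noncomputable def kernelFun (x : ℝ) : ℝ := kernelPoly (Real.sin (angle x))

/-- The derivative of `kernelFun`. -/
noncomputable def kernelFun₁ (x : ℝ) : ℝ :=
  kernelPoly₁ (Real.sin (angle x)) *
    (Real.cos (angle x) / displacement₁ (Real.sin (angle x)))

theorem hasDerivAt_kernelFun (x : ℝ) : HasDerivAt kernelFun (kernelFun₁ x) x :=
  (hasDerivAt_kernelPoly _).comp x (hasDerivAt_sin_angle x)

/-- `kernelPoly` comes from differentiating `displacement (M * sin θ)` in `M` at fixed `x =
travelTime M θ`. At `M = 1` this is `s * displacement₁ s - cos θ * ∂_M travelTime`, where the terms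
linear in `θ` cancel because `T'(1) = 0`; a polynomial in `s = sin θ` remains. -/
theorem hasDerivAt_kernelFun₁ (x : ℝ) :
    HasDerivAt kernelFun₁ (-(baseSlope (Real.sin (angle x)) * kernelFun x)) x := by
  have hs := hasDerivAt_sin_angle x
  have h0 := (displacement₁_pos (Real.sin (angle x))).ne'
  have := ((hasDerivAt_kernelPoly₁ _).comp x hs).mul
    ((hasDerivAt_angle x).cos.div ((hasDerivAt_displacement₁ _).comp x hs) h0)
  refine this.congr_deriv ?_
  simp only [Function.comp, Pi.div_apply, baseSlope, kernelFun]
  have hc := Real.cos_sq' (angle x)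
  set s := Real.sin (angle x)
  set c := Real.cos (angle x)
  field_simp
  rw [hc]
  simp only [displacement₁, displacement₂, kernelPoly, kernelPoly₁]
  ring

theorem contDiff_kernelFun : ContDiff ℝ ∞ kernelFun := by
  have : ContDiff ℝ ∞ kernelPoly := by unfold kernelPoly; fun_prop
  exact this.comp (Real.contDiff_sin.comp contDiff_angle)

theorem le_kernelPoly {s : ℝ} (h0 : 0 ≤ s) (h1 : s ≤ 1) : s / 5 ≤ kernelPoly s := by
  have : kernelPoly s = s / 5 + s ^ 3 * (7 / 10 - 7 / 25 * s ^ 2) := by unfold kernelPoly; ring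
  have h2 : 0 ≤ s ^ 3 * (7 / 10 - 7 / 25 * s ^ 2) := mul_nonneg (by positivity) (by nlinarith)
  linarith

theorem kernelFun_pos {x : ℝ} (hx : x ∈ Ioo 0 (11 / 20 * Real.pi)) : 0 < kernelFun x := by
  have := sin_angle_pos hx
  have := le_kernelPoly this.le (Real.sin_le_one _)
  rw [kernelFun]; linarith

theorem kernelFun_zero : kernelFun 0 = 0 := by simp [kernelFun, kernelPoly]

theorem kernelFun_end : kernelFun (11 / 20 * Real.pi) = 0 := by
  simp [kernelFun, kernelPoly, angle_end]

/-- The numerator is at most `10` and the denominator at least `(1/5)³`. -/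
theorem baseSlope_le {s : ℝ} (h0 : 0 ≤ s) (h1 : s ≤ 1) : baseSlope s ≤ 1250 := by
  have h := le_displacement₁ s
  have h3 : (1 / 5 : ℝ) ^ 3 ≤ displacement₁ s ^ 3 := pow_le_pow_left₀ (by norm_num) h 3
  rw [baseSlope, div_le_iff₀ (pow_pos (displacement₁_pos s) 3)]
  have h4 : displacement₁ s - s * displacement₂ s ≤ 10 := by
    have e : displacement₁ s - s * displacement₂ s
        = 1 / 5 - 21 / 10 * s ^ 2 + 42 / 5 * s ^ 4 - 28 / 5 * s ^ 6 := by
      unfold displacement₁ displacement₂; ring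
    have : s ^ 4 ≤ 1 := pow_le_one₀ h0 h1
    rw [e]; nlinarith [sq_nonneg s, pow_nonneg h0 6]
  norm_num at h3; linarith

/-- A quantitative Hopf lemma: small `kernelFun` forces `sin ≤ 1/2`, so `cos² ≥ 3/4`, and `3/100 =
(1/5)² * (3/4)`. -/
theorem le_kernelFun₁_sq {x : ℝ} (hx : x ∈ Ioo 0 (11 / 20 * Real.pi))
    (hw : kernelFun x ≤ 1 / 10) : 3 / 100 ≤ kernelFun₁ x ^ 2 := by
  have h0 := (sin_angle_pos hx).le
  have h := le_kernelPoly h0 (Real.sin_le_one _)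
  rw [kernelFun] at hw
  have hc := Real.cos_sq' (angle x)
  rw [kernelFun₁]
  set s := Real.sin (angle x)
  set c := Real.cos (angle x)
  have hs : s ≤ 1 / 2 := by linarith
  have hs2 : s ^ 2 ≤ 1 / 4 := by nlinarith
  have hk : 1 / 5 ≤ kernelPoly₁ s := by
    unfold kernelPoly₁; nlinarith [sq_nonneg s]
  have hd : displacement₁ s ≤ 1 := by
    have h6 : s ^ 6 ≤ (1 / 2) ^ 6 := pow_le_pow_left₀ h0 hs 6
    unfold displacement₁; nlinarith [pow_nonneg h0 4]
  have hd0 := displacement₁_pos s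
  rw [mul_pow, div_pow, hc, ← mul_div_assoc, le_div_iff₀ (by positivity)]
  have h1 : (1 / 5 : ℝ) ^ 2 ≤ kernelPoly₁ s ^ 2 := pow_le_pow_left₀ (by norm_num) hk 2
  have h2 : displacement₁ s ^ 2 ≤ 1 := pow_le_one₀ hd0.le hd
  nlinarith

/-! ### Uniqueness by comparison of travel times. -/

/-- By Darboux a nonvanishing derivative keeps its sign, so no continuity of `v` is needed; the end
values select `+1`. -/
theorem sub_eq_sub_of_deriv_sq_eq_one {y v : ℝ → ℝ} {a b : ℝ} (hab : a ≤ b)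
    (hc : ContinuousOn y (Icc a b)) (hd : ∀ x ∈ Ioo a b, HasDerivAt y (v x) x)
    (hv : ∀ x ∈ Ioo a b, v x ^ 2 = 1) (hlt : y a < y b) {x : ℝ} (hx : x ∈ Icc a b) :
    y x - y a = x - a := by
  have hne : ∀ x ∈ Ioo a b, v x ≠ 0 := fun x hx h => by
    have := hv x hx; rw [h] at this; norm_num at this
  have hdiff : DifferentiableOn ℝ y (interior (Icc a b)) := by
    rw [interior_Icc]
    exact fun x hx => (hd x hx).differentiableAt.differentiableWithinAt
  rcases hasDerivWithinAt_forall_lt_or_forall_gt_of_forall_ne (convex_Ioo a b)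
    (fun x hx => (hd x hx).hasDerivWithinAt) hne with h | h
  · have := (convex_Icc a b).image_sub_le_mul_sub_of_deriv_le hc hdiff (C := 0)
      (fun x hx => by
        rw [interior_Icc] at hx; rw [(hd x hx).deriv]; exact (h x hx).le)
      a (left_mem_Icc.2 hab) b (right_mem_Icc.2 hab) hab
    linarith
  · have h1 : ∀ x ∈ interior (Icc a b), deriv y x = 1 := fun x hx => by
      rw [interior_Icc] at hx
      rw [(hd x hx).deriv]
      nlinarith [h x hx, hv x hx]
    have e1 := (convex_Icc a b).image_sub_le_mul_sub_of_deriv_le hc hdiff (C := 1)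
      (fun x hx => (h1 x hx).le) a (left_mem_Icc.2 hab) x hx hx.1
    have e2 := (convex_Icc a b).mul_sub_le_image_sub_of_le_deriv hc hdiff (C := 1)
      (fun x hx => (h1 x hx).ge) a (left_mem_Icc.2 hab) x hx hx.1
    linarith

/-- The potential of `reaction`. -/
noncomputable def potential (s : ℝ) : ℝ := ∫ t in (0 : ℝ)..s, reaction t

theorem hasDerivAt_potential (s : ℝ) : HasDerivAt potential (reaction s) s :=
  intervalIntegral.integral_hasDerivAt_right (continuous_reaction.intervalIntegrable _ _)
    (continuous_reaction.stronglyMeasurableAtFilter _ _) continuous_reaction.continuousAt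

theorem hasDerivAt_rootEnergy_sq_sub_potential (s : ℝ) :
    HasDerivAt (fun s => rootEnergy s ^ 2 / 2 - potential s) (baseReaction s - reaction s) s := by
  have := (((hasDerivAt_rootEnergy s).pow 2).div_const 2).sub (hasDerivAt_potential s)
  refine this.congr_deriv ?_
  simp only [baseReaction]; norm_num; field_simp

theorem potential_sub_le {s m : ℝ} (hs : 0 ≤ s) (hsm : s ≤ m) :
    2 * (potential m - potential s) ≤ rootEnergy m ^ 2 - rootEnergy s ^ 2 := by
  have hmono : MonotoneOn (fun s => rootEnergy s ^ 2 / 2 - potential s) (Ici 0) := by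
    refine monotoneOn_of_deriv_nonneg (convex_Ici 0)
      (fun s _ => (hasDerivAt_rootEnergy_sq_sub_potential s).continuousAt.continuousWithinAt)
      (fun s _ => (hasDerivAt_rootEnergy_sq_sub_potential s).differentiableAt.differentiableWithinAt)
      fun s hs => ?_
    rw [interior_Ici] at hs
    rw [(hasDerivAt_rootEnergy_sq_sub_potential s).deriv]
    exact sub_nonneg.2 (reaction_le_baseReaction (le_of_lt hs))
  have := hmono hs (hs.trans hsm : m ∈ Ici 0) hsm
  simp only at this
  linarith

theorem potential_eq {s : ℝ} (hs : s ∈ Icc (0 : ℝ) (1 / 2)) :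
    2 * potential s = rootEnergy s ^ 2 := by
  have h : ∀ x ∈ uIcc 0 s, HasDerivAt (fun s => rootEnergy s ^ 2 / 2) (reaction x) x := by
    intro x hx
    rw [uIcc_of_le hs.1] at hx
    rw [reaction_eq_baseReaction ⟨hx.1, hx.2.trans hs.2⟩]
    refine (((hasDerivAt_rootEnergy x).pow 2).div_const 2).congr_deriv ?_
    simp only [baseReaction]; norm_num; field_simp
  have := intervalIntegral.integral_eq_sub_of_hasDerivAt h
    (continuous_reaction.intervalIntegrable _ _)
  rw [potential, this]; simp; ring

namespace IsPositiveSolution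

variable {f u : ℝ → ℝ} {L : ℝ}

theorem hasDerivAt (h : IsPositiveSolution f L u) {x : ℝ} (hx : x ∈ Ioo 0 L) :
    HasDerivAt u (deriv u x) x :=
  ((h.contDiffOn.differentiableOn (by norm_num)).differentiableAt
    (isOpen_Ioo.mem_nhds hx)).hasDerivAt

theorem hasDerivAt_deriv (h : IsPositiveSolution f L u) {x : ℝ} (hx : x ∈ Ioo 0 L) :
    HasDerivAt (deriv u) (-f (u x)) x := by
  have h1 : ContDiffOn ℝ (1 + 1) u (Ioo 0 L) := by
    rw [one_add_one_eq_two]; exact h.contDiffOn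
  have h2 := ((contDiffOn_succ_iff_deriv_of_isOpen isOpen_Ioo).1 h1).2.2
  have := ((h2.differentiableOn (by norm_num)).differentiableAt
    (isOpen_Ioo.mem_nhds hx)).hasDerivAt
  rw [← h.eqn x hx, neg_neg]; exact this

theorem nonneg (h : IsPositiveSolution f L u) {x : ℝ} (hx : x ∈ Icc 0 L) : 0 ≤ u x := by
  rcases eq_or_lt_of_le hx.1 with rfl | h0
  · exact h.left.ge
  rcases eq_or_lt_of_le hx.2 with rfl | h1
  · exact h.right.ge
  exact (h.pos x ⟨h0, h1⟩).le

/-- The energy `u'² / 2 + potential u` is conserved, and `u'` vanishes at the maximum. -/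
theorem energy_eq (h : IsPositiveSolution reaction L u) {x₀ x : ℝ} (hx₀ : x₀ ∈ Ioo 0 L)
    (hmax : ∀ x ∈ Icc 0 L, u x ≤ u x₀) (hx : x ∈ Ioo 0 L) :
    deriv u x ^ 2 = 2 * (potential (u x₀) - potential (u x)) := by
  have hd : ∀ x ∈ Ioo 0 L, HasDerivAt (fun x => deriv u x ^ 2 / 2 + potential (u x)) 0 x := by
    intro x hx
    refine ((((h.hasDerivAt_deriv hx).pow 2).div_const 2).add
      ((hasDerivAt_potential _).comp x (h.hasDerivAt hx))).congr_deriv ?_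
    norm_num; ring
  have := isOpen_Ioo.is_const_of_deriv_eq_zero isPreconnected_Ioo
    (fun x hx => (hd x hx).differentiableAt.differentiableWithinAt)
    (fun x hx => (hd x hx).deriv) hx hx₀
  have h0 : deriv u x₀ = 0 := by
    refine IsLocalMax.deriv_eq_zero ?_
    filter_upwards [isOpen_Ioo.mem_nhds hx₀] with x hx using hmax x (Ioo_subset_Icc_self hx)
  simp only [h0] at this
  linarith

end IsPositiveSolution

/-- Along a solution with maximum `displacement M`, the time in which the comparison solution of
maximum `displacement M` reaches the same value. -/
noncomputable def comparisonTime (u : ℝ → ℝ) (M x : ℝ) : ℝ :=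
  travelTime M (Real.arcsin (rootEnergy (u x) / M))

theorem continuous_travelTime (M : ℝ) : Continuous (travelTime M) :=
  continuous_iff_continuousAt.2 fun θ => (hasDerivAt_travelTime M θ).continuousAt

/-- The factors `displacement₁` from `travelTime` and from `rootEnergy` cancel. Strictness in `hM`
avoids the endpoint `1` of `arcsin`. -/
theorem hasDerivAt_comparisonTime {u : ℝ → ℝ} {M x u' : ℝ} (hu : HasDerivAt u u' x)
    (h0 : 0 ≤ rootEnergy (u x)) (hM : rootEnergy (u x) < M) :
    HasDerivAt (comparisonTime u M) (u' / √(M ^ 2 - rootEnergy (u x) ^ 2)) x := by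
  have hM0 : 0 < M := h0.trans_lt hM
  have h1 : rootEnergy (u x) / M < 1 := (div_lt_one hM0).2 hM
  have h2 : 0 ≤ rootEnergy (u x) / M := by positivity
  have hq := ((hasDerivAt_rootEnergy (u x)).comp x hu).div_const M
  have hd := (hasDerivAt_travelTime M _).comp x
    ((Real.hasDerivAt_arcsin (by simp only [Function.comp]; linarith)
      (by simp only [Function.comp]; exact h1.ne)).comp x hq)
  refine hd.congr_deriv ?_
  simp only [Function.comp]
  rw [Real.sin_arcsin (by linarith) h1.le, mul_div_cancel₀ _ hM0.ne']
  have h3 : √(M ^ 2 - rootEnergy (u x) ^ 2) = M * √(1 - (rootEnergy (u x) / M) ^ 2) := by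
    rw [← Real.sqrt_sq hM0.le, ← Real.sqrt_mul (sq_nonneg _), Real.sqrt_sq hM0.le]
    congr 1; field_simp
  have h4 : 0 < √(1 - (rootEnergy (u x) / M) ^ 2) := Real.sqrt_pos.2 (by nlinarith)
  have h5 := (displacement₁_pos (rootEnergy (u x))).ne'
  rw [h3]; field_simp

/-- Since `reaction ≤ baseReaction`, the energy identity bounds the speed of the comparison time by
`1`. Hence rise and fall together take at least `2 T(M)`, which rules out `M > 1`. For `M ≤ 1` the
two reactions agree along `u`, the speed is exactly `1`, and `2 T(M) = L` forces `M = 1`. -/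
theorem IsPositiveSolution.comparisonTime_eq {u : ℝ → ℝ}
    (h : IsPositiveSolution reaction (11 / 20 * Real.pi) u) {x : ℝ}
    (hx : x ∈ Icc 0 (11 / 20 * Real.pi)) :
    rootEnergy (u x) ∈ Icc (0 : ℝ) 1 ∧
      comparisonTime u 1 x = min x (11 / 20 * Real.pi - x) := by
  set L := 11 / 20 * Real.pi with hLdef
  have hL : 0 < L := by positivity
  obtain ⟨x₀, hx₀, hmax'⟩ := isCompact_Icc.exists_isMaxOn (nonempty_Icc.2 hL.le) h.continuousOn
  have hmax : ∀ x ∈ Icc 0 L, u x ≤ u x₀ := fun x hx => hmax' hx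
  have hm0 : 0 < u x₀ := (h.pos (L / 2) ⟨by linarith, by linarith⟩).trans_le
    (hmax _ ⟨by linarith, by linarith⟩)
  have hinner : ∀ z ∈ Icc 0 L, u z = u x₀ → z ∈ Ioo 0 L := by
    refine fun z hz hzm => ⟨hz.1.lt_of_ne ?_, hz.2.lt_of_ne ?_⟩
    · rintro rfl; rw [h.left] at hzm; linarith
    · intro e; rw [e, h.right] at hzm; linarith
  have hx₀I := hinner x₀ hx₀ rfl
  set M := rootEnergy (u x₀) with hM
  have hM0 : 0 < M := rootEnergy_pos hm0
  set y := comparisonTime u M with hy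
  have hycont : ContinuousOn y (Icc 0 L) :=
    (continuous_travelTime M).comp_continuousOn (Real.continuous_arcsin.comp_continuousOn
      ((continuous_rootEnergy.comp_continuousOn h.continuousOn).div_const M))
  have hyd : ∀ x ∈ Ioo 0 L, u x < u x₀ →
      HasDerivAt y (deriv u x / √(M ^ 2 - rootEnergy (u x) ^ 2)) x := fun x hx hlt =>
    hasDerivAt_comparisonTime (h.hasDerivAt hx)
      (rootEnergy_nonneg (h.nonneg (Ioo_subset_Icc_self hx))) (rootEnergy_strictMono hlt)
  have hden : ∀ x ∈ Ioo 0 L, u x < u x₀ → 0 < M ^ 2 - rootEnergy (u x) ^ 2 := fun x hx hlt => by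
    have h1 := rootEnergy_nonneg (h.nonneg (Ioo_subset_Icc_self hx))
    have h2 : rootEnergy (u x) < M := rootEnergy_strictMono hlt
    nlinarith
  have hsq : ∀ x ∈ Ioo 0 L, u x < u x₀ →
      (deriv u x / √(M ^ 2 - rootEnergy (u x) ^ 2)) ^ 2 =
        2 * (potential (u x₀) - potential (u x)) / (M ^ 2 - rootEnergy (u x) ^ 2) :=
    fun x hx hlt => by
      rw [div_pow, Real.sq_sqrt (hden x hx hlt).le, h.energy_eq hx₀I hmax hx]
  have hymax : ∀ z, u z = u x₀ → y z = travelTime M (Real.pi / 2) := fun z hz => by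
    rw [hy, comparisonTime, hz, div_self hM0.ne', Real.arcsin_one]
  have hy0 : y 0 = 0 := by simp [hy, comparisonTime, h.left]
  have hyL : y L = 0 := by simp [hy, comparisonTime, h.right]
  have hYpos : 0 < travelTime M (Real.pi / 2) := by
    simpa using travelTime_strictMono M (by positivity : 0 < Real.pi / 2)
  have hScomp : IsCompact (Icc 0 L ∩ u ⁻¹' {u x₀}) :=
    isCompact_Icc.of_isClosed_subset
      (h.continuousOn.preimage_isClosed_of_isClosed isClosed_Icc isClosed_singleton)
      inter_subset_left
  -- The first and last maximum points `a` and `b`: outside `[a, b]` the solution is strictly below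
  -- its maximum, where the comparison time is differentiable.
  obtain ⟨a, ⟨haI, ham⟩, hleast⟩ := hScomp.exists_isLeast ⟨x₀, hx₀, rfl⟩
  obtain ⟨b, ⟨hbI, hbm⟩, hgreatest⟩ := hScomp.exists_isGreatest ⟨x₀, hx₀, rfl⟩
  have ham : u a = u x₀ := ham
  have hbm : u b = u x₀ := hbm
  have hab : a ≤ b := hleast ⟨hbI, hbm⟩
  have ha := hinner a haI ham
  have hb := hinner b hbI hbm
  have hlta : ∀ x ∈ Ioo 0 a, x ∈ Ioo 0 L ∧ u x < u x₀ := fun x hx => by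
    have hxI : x ∈ Ioo 0 L := ⟨hx.1, hx.2.trans ha.2⟩
    refine ⟨hxI, (hmax x (Ioo_subset_Icc_self hxI)).lt_of_ne fun e => ?_⟩
    exact absurd (hleast ⟨Ioo_subset_Icc_self hxI, e⟩) (not_le.2 hx.2)
  have hltb : ∀ x ∈ Ioo b L, x ∈ Ioo 0 L ∧ u x < u x₀ := fun x hx => by
    have hxI : x ∈ Ioo 0 L := ⟨hb.1.trans hx.1, hx.2⟩
    refine ⟨hxI, (hmax x (Ioo_subset_Icc_self hxI)).lt_of_ne fun e => ?_⟩
    exact absurd (hgreatest ⟨Ioo_subset_Icc_self hxI, e⟩) (not_le.2 hx.1)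
  have habs : ∀ x ∈ Ioo 0 L, u x < u x₀ →
      |deriv u x / √(M ^ 2 - rootEnergy (u x) ^ 2)| ≤ 1 := fun x hx hlt => by
    rw [← sq_le_one_iff_abs_le_one, hsq x hx hlt, div_le_one (hden x hx hlt)]
    exact potential_sub_le (h.nonneg (Ioo_subset_Icc_self hx)) hlt.le
  have hya : y a - y 0 ≤ 1 * (a - 0) := by
    refine (convex_Icc 0 a).image_sub_le_mul_sub_of_deriv_le
      (hycont.mono (Icc_subset_Icc_right ha.2.le)) ?_ ?_ 0 (left_mem_Icc.2 ha.1.le) a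
      (right_mem_Icc.2 ha.1.le) ha.1.le
    · rw [interior_Icc]
      exact fun x hx => (hyd x (hlta x hx).1 (hlta x hx).2).differentiableAt.differentiableWithinAt
    · rw [interior_Icc]
      intro x hx
      rw [(hyd x (hlta x hx).1 (hlta x hx).2).deriv]
      exact (abs_le.1 (habs x (hlta x hx).1 (hlta x hx).2)).2
  have hyb : -1 * (L - b) ≤ y L - y b := by
    refine (convex_Icc b L).mul_sub_le_image_sub_of_le_deriv
      (hycont.mono (Icc_subset_Icc_left hb.1.le)) ?_ ?_ b (left_mem_Icc.2 hb.2.le) L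
      (right_mem_Icc.2 hb.2.le) hb.2.le
    · rw [interior_Icc]
      exact fun x hx => (hyd x (hltb x hx).1 (hltb x hx).2).differentiableAt.differentiableWithinAt
    · rw [interior_Icc]
      intro x hx
      rw [(hyd x (hltb x hx).1 (hltb x hx).2).deriv]
      exact (abs_le.1 (habs x (hltb x hx).1 (hltb x hx).2)).1
  rw [hymax a ham, hy0] at hya
  rw [hymax b hbm, hyL] at hyb
  have hM1 : M ≤ 1 := by
    by_contra! hlt
    have h1 : 2 * travelTime M (Real.pi / 2) ≤ L := by linarith
    rw [travelTime_pi_div_two] at h1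
    have h2 : 0 < (M ^ 2 - 1) ^ 3 := pow_pos (by nlinarith) 3
    nlinarith [mul_pos Real.pi_pos h2]
  have hm_half : u x₀ ≤ 1 / 2 := by
    have := displacement_strictMono.monotone hM1
    rwa [hM, displacement_rootEnergy, displacement_one] at this
  have hpot : ∀ x ∈ Icc 0 L, 2 * (potential (u x₀) - potential (u x)) =
      M ^ 2 - rootEnergy (u x) ^ 2 := fun x hx => by
    rw [mul_sub, potential_eq ⟨hm0.le, hm_half⟩,
      potential_eq ⟨h.nonneg hx, (hmax x hx).trans hm_half⟩]
  have hsq1 : ∀ x ∈ Ioo 0 L, u x < u x₀ →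
      (deriv u x / √(M ^ 2 - rootEnergy (u x) ^ 2)) ^ 2 = 1 := fun x hx hlt => by
    rw [hsq x hx hlt, hpot x (Ioo_subset_Icc_self hx), div_self (hden x hx hlt).ne']
  have hleft : ∀ x ∈ Icc 0 a, y x = x := fun x hx => by
    have := sub_eq_sub_of_deriv_sq_eq_one ha.1.le (hycont.mono (Icc_subset_Icc_right ha.2.le))
      (fun x hx => hyd x (hlta x hx).1 (hlta x hx).2)
      (fun x hx => hsq1 x (hlta x hx).1 (hlta x hx).2) (by rw [hy0, hymax a ham]; exact hYpos) hx
    rw [hy0] at this; linarith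
  have hright : ∀ x ∈ Icc b L, y x = travelTime M (Real.pi / 2) - (x - b) := fun x hx => by
    have := sub_eq_sub_of_deriv_sq_eq_one (y := fun x => -y x) hb.2.le
      (hycont.mono (Icc_subset_Icc_left hb.1.le)).neg
      (fun x hx => (hyd x (hltb x hx).1 (hltb x hx).2).neg)
      (fun x hx => by rw [neg_sq]; exact hsq1 x (hltb x hx).1 (hltb x hx).2)
      (by rw [hyL, hymax b hbm]; linarith) hx
    rw [hymax b hbm] at this; linarith
  -- If `a < b`, a lower interior minimum would have zero slope, contradicting unit speed; otherwise
  -- `u` is constant on `[a, b]`, contradicting positivity of the reaction there.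
  have hab' : a = b := by
    by_contra hne
    have hlt : a < b := hab.lt_of_ne hne
    have hsub : Icc a b ⊆ Icc 0 L := Icc_subset_Icc ha.1.le hb.2.le
    obtain ⟨z, hz, hzmin⟩ := isCompact_Icc.exists_isMinOn (nonempty_Icc.2 hab)
      (h.continuousOn.mono hsub)
    rcases (hmax z (hsub hz)).lt_or_eq with hzlt | hzeq
    · have hzI : z ∈ Ioo a b := by
        refine ⟨hz.1.lt_of_ne ?_, hz.2.lt_of_ne ?_⟩
        · rintro rfl; exact hzlt.ne ham
        · rintro rfl; exact hzlt.ne hbm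
      have hzL : z ∈ Ioo 0 L := ⟨ha.1.trans hzI.1, hzI.2.trans hb.2⟩
      have hd0 : deriv u z = 0 := (hzmin.isLocalMin (Icc_mem_nhds hzI.1 hzI.2)).deriv_eq_zero
      have := hsq1 z hzL hzlt
      rw [hd0] at this; norm_num at this
    · have hconst : ∀ x ∈ Icc a b, u x = u x₀ := fun x hx =>
        le_antisymm (hmax x (hsub hx)) (hzeq ▸ hzmin hx)
      have hc : (a + b) / 2 ∈ Ioo a b := ⟨by linarith, by linarith⟩
      have hcL : (a + b) / 2 ∈ Ioo 0 L := ⟨ha.1.trans hc.1, hc.2.trans hb.2⟩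
      have hd : deriv u =ᶠ[nhds ((a + b) / 2)] fun _ => 0 := by
        filter_upwards [isOpen_Ioo.mem_nhds hc] with x hx
        have : u =ᶠ[nhds x] fun _ => u x₀ := by
          filter_upwards [isOpen_Ioo.mem_nhds hx] with t ht
          exact hconst t (Ioo_subset_Icc_self ht)
        rw [this.deriv_eq, deriv_const]
      have h1 := h.eqn _ hcL
      rw [hd.deriv_eq, deriv_const, hconst _ (Ioo_subset_Icc_self hc),
        reaction_eq_baseReaction ⟨hm0.le, hm_half⟩] at h1
      have := baseReaction_pos hm0
      linarith
  subst hab'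
  have hYa : travelTime M (Real.pi / 2) = a := by
    rw [← hymax a ham, hleft a (right_mem_Icc.2 ha.1.le)]
  have hYL : travelTime M (Real.pi / 2) = L - a := by
    have := hright L (right_mem_Icc.2 hb.2.le)
    rw [hyL] at this; linarith
  have hMeq : M = 1 := by
    have h1 : 2 * travelTime M (Real.pi / 2) = L := by linarith
    rw [travelTime_pi_div_two, hLdef] at h1
    have h2 : Real.pi * (M ^ 2 - 1) ^ 3 = 0 := by linarith
    have h3 : M ^ 2 - 1 = 0 := by simpa [Real.pi_ne_zero] using h2
    nlinarith
  refine ⟨⟨rootEnergy_nonneg (h.nonneg hx), ?_⟩, ?_⟩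
  · rw [← hMeq]; exact rootEnergy_strictMono.monotone (hmax x hx)
  rw [← hMeq]
  rcases le_total x a with hxa | hxa
  · rw [min_eq_left (by linarith)]; exact hleft x ⟨hx.1, hxa⟩
  · rw [min_eq_right (by linarith)]
    have := hright x ⟨hxa, hx.2⟩
    rw [← hy, this]; linarith

theorem IsPositiveSolution.eqOn {u v : ℝ → ℝ}
    (hu : IsPositiveSolution reaction (11 / 20 * Real.pi) u)
    (hv : IsPositiveSolution reaction (11 / 20 * Real.pi) v) :
    EqOn u v (Icc 0 (11 / 20 * Real.pi)) := by
  intro x hx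
  obtain ⟨hu1, hu2⟩ := hu.comparisonTime_eq hx
  obtain ⟨hv1, hv2⟩ := hv.comparisonTime_eq hx
  have h := (travelTime_strictMono 1).injective (hu2.trans hv2.symm)
  rw [div_one, div_one] at h
  refine rootEnergy_strictMono.injective (Real.injOn_arcsin ?_ ?_ h)
  · exact ⟨by linarith [hu1.1], hu1.2⟩
  · exact ⟨by linarith [hv1.1], hv1.2⟩

/-! ### Weak derivatives and testing of supersolutions. -/

theorem integrable_mul_of_tsupport_subset {Ω : Set ℝ} {g h : ℝ → ℝ}
    (hg : LocallyIntegrableOn g Ω) (hh : Continuous h) (hc : HasCompactSupport h)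
    (hs : tsupport h ⊆ Ω) : Integrable fun x => g x * h x := by
  refine (integrableOn_iff_integrable_of_support_subset (s := tsupport h) fun x hx => ?_).1
    ((hg.integrableOn_compact_subset hs hc).mul_continuousOn hh.continuousOn hc)
  refine subset_tsupport h fun h0 => hx ?_
  simp [h0]

theorem isWeakDerivOn_of_hasDerivAt {Ω : Set ℝ} {u u' : ℝ → ℝ}
    (hu : ∀ x, HasDerivAt u (u' x) x) (hu' : Continuous u') : IsWeakDerivOn Ω u u' := by
  have hcont : Continuous u := continuous_iff_continuousAt.2 fun x => (hu x).continuousAt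
  refine ⟨hcont.locallyIntegrable.locallyIntegrableOn _,
    hu'.locallyIntegrable.locallyIntegrableOn _, fun η hη hc hs => ?_⟩
  have hη1 : Continuous (deriv η) := hη.continuous_deriv (by simp)
  have hfull : ∀ g h : ℝ → ℝ, tsupport h ⊆ Ω → ∫ x in Ω, g x * h x = ∫ x, g x * h x := by
    intro g h hs
    refine setIntegral_eq_integral_of_forall_compl_eq_zero fun x hx => ?_
    rw [image_eq_zero_of_notMem_tsupport fun h => hx (hs h), mul_zero]
  have hts : tsupport (deriv η) ⊆ tsupport η := tsupport_deriv_subset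
  rw [hfull _ _ (hts.trans hs), hfull _ _ hs]
  refine integral_mul_deriv_eq_deriv_mul_of_integrable (u := u) (v := η) (fun x _ => hu x)
    (fun x _ => (hη.differentiable (by simp) x).hasDerivAt) ?_ ?_ ?_
  · exact integrable_mul_of_tsupport_subset (hcont.locallyIntegrable.locallyIntegrableOn univ) hη1
      hc.deriv (subset_univ _)
  · exact integrable_mul_of_tsupport_subset (hu'.locallyIntegrable.locallyIntegrableOn univ)
      hη.continuous hc (subset_univ _)
  · exact integrable_mul_of_tsupport_subset (hcont.locallyIntegrable.locallyIntegrableOn univ)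
      hη.continuous hc (subset_univ _)

theorem hasPositiveSupersolution_zero {Ω : Set ℝ} {V w w₁ w₂ : ℝ → ℝ} (hΩ : MeasurableSet Ω)
    (hw : ∀ x, HasDerivAt w (w₁ x) x) (hw₁ : ∀ x, HasDerivAt w₁ (w₂ x) x) (hw₂ : Continuous w₂)
    (hpos : ∀ x ∈ Ω, 0 < w x) (hle : ∀ x ∈ Ω, w₂ x + V x * w x ≤ 0) :
    HasPositiveSupersolution V Ω 0 := by
  refine ⟨w, w₁, w₂, fun x _ => (hw x).continuousAt.continuousWithinAt,
    isWeakDerivOn_of_hasDerivAt hw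
      (continuous_iff_continuousAt.2 fun x => (hw₁ x).continuousAt),
    isWeakDerivOn_of_hasDerivAt hw₁ hw₂, hpos, ?_⟩
  filter_upwards [ae_restrict_mem hΩ] with x hx
  linarith [hle x hx]

/-- A supersolution tested against a nonnegative test function. -/
theorem setIntegral_supersolution_nonpos {Ω : Set ℝ} {V ψ ψ₁ ψ₂ η : ℝ → ℝ} {μ : ℝ}
    (hΩ : IsOpen Ω) (hV : ContinuousOn V Ω) (hψ : ContinuousOn ψ Ω)
    (h1 : IsWeakDerivOn Ω ψ ψ₁) (h2 : IsWeakDerivOn Ω ψ₁ ψ₂)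
    (hle : ∀ᵐ x ∂(volume.restrict Ω), ψ₂ x + V x * ψ x + μ * ψ x ≤ 0)
    (hη : ContDiff ℝ ∞ η) (hc : HasCompactSupport η) (hs : tsupport η ⊆ Ω) (h0 : ∀ x, 0 ≤ η x) :
    IntegrableOn (fun x => ψ x * (deriv (deriv η) x + (V x + μ) * η x)) Ω ∧
      ∫ x in Ω, ψ x * (deriv (deriv η) x + (V x + μ) * η x) ≤ 0 := by
  have hη1 : ContDiff ℝ ∞ (deriv η) := hη.deriv'
  have hη2 : Continuous (deriv (deriv η)) := hη1.continuous_deriv (by simp)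
  have hts : tsupport (deriv η) ⊆ Ω := tsupport_deriv_subset.trans hs
  have hts2 : tsupport (deriv (deriv η)) ⊆ Ω := tsupport_deriv_subset.trans hts
  have e1 := h1.integral_eq _ hη1 hc.deriv hts
  have e2 := h2.integral_eq _ hη hc hs
  have i1 : IntegrableOn (fun x => ψ x * deriv (deriv η) x) Ω :=
    (integrable_mul_of_tsupport_subset h1.locallyIntegrableOn hη2 hc.deriv.deriv hts2).integrableOn
  have i2 : IntegrableOn (fun x => ψ₂ x * η x) Ω :=
    (integrable_mul_of_tsupport_subset h2.locallyIntegrableOn_deriv hη.continuous hc hs).integrableOn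
  have i3 : IntegrableOn (fun x => ((V x + μ) * ψ x) * η x) Ω := by
    refine (integrable_mul_of_tsupport_subset (g := fun x => (V x + μ) * ψ x) ?_
      hη.continuous hc hs).integrableOn
    exact ((hV.add continuousOn_const).mul hψ).locallyIntegrableOn hΩ.measurableSet
  have hsplit : (fun x => ψ x * (deriv (deriv η) x + (V x + μ) * η x)) =
      fun x => ψ x * deriv (deriv η) x + (V x + μ) * ψ x * η x := by funext x; ring
  rw [hsplit]
  refine ⟨i1.add i3, ?_⟩
  rw [integral_add i1 i3, e1, e2, neg_neg, ← integral_add i2 i3]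
  refine integral_nonpos_of_ae ?_
  filter_upwards [hle] with x hx
  have := mul_nonpos_of_nonpos_of_nonneg hx (h0 x)
  simp only [Pi.zero_apply]
  linarith

/-! ### Truncation of the kernel and the upper bound for the eigenvalue. -/

theorem hasDerivAt_expNegInvGlue (x : ℝ) :
    HasDerivAt expNegInvGlue (x⁻¹ ^ 2 * expNegInvGlue x) x := by
  simpa using expNegInvGlue.hasDerivAt_polynomial_eval_inv_mul 1 x

theorem hasDerivAt_inv_sq_mul_expNegInvGlue (x : ℝ) :
    HasDerivAt (fun x => x⁻¹ ^ 2 * expNegInvGlue x)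
      ((x⁻¹ ^ 4 - 2 * x⁻¹ ^ 3) * expNegInvGlue x) x := by
  have := expNegInvGlue.hasDerivAt_polynomial_eval_inv_mul (Polynomial.X ^ 2) x
  simp only [Polynomial.eval_pow, Polynomial.eval_X] at this
  refine this.congr_deriv ?_
  simp; left; ring


/-- The key inequality for the truncation `w * exp (-δ / (w - δ / 4))`, with `t = δ / (w - δ / 4)`,
`v` the potential and `a` the slope of `w`. -/
theorem truncation_pos {K μ c δ t₀ t w v a : ℝ} (hK : 0 < K) (hδ : 0 < δ)
    (ht₀ : 0 < t₀) (ht₀1 : t₀ ≤ 1) (hμ : 2 * K * t₀ ≤ μ) (ht : 0 < t)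
    (hw : w = δ / 4 + δ / t) (hv : v ≤ K) (ha : t₀ < t → c ≤ a ^ 2)
    (hc : 4 * K * δ ^ 2 ≤ c * t₀ ^ 3) :
    0 < 2 * a * (t ^ 2 * (a / δ)) +
      w * ((t ^ 4 - 2 * t ^ 3) * (a / δ) * (a / δ) + t ^ 2 * (-(v * w) / δ)) + μ * w := by
  have hw0 : 0 < w := by rw [hw]; positivity
  have hkey : 0 < a ^ 2 * t ^ 4 / (2 * δ ^ 2) - K * (t + t ^ 2 / 4) + μ := by
    have hμ0 : 0 < μ := lt_of_lt_of_le (by positivity) hμ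
    -- Away from the edge of the support (`t ≤ t₀`) the term `μ` absorbs the potential; near it the
    -- slope bound lets the `t ^ 4` term dominate.
    rcases le_or_gt t t₀ with h | h
    · have h1 : t + t ^ 2 / 4 ≤ 5 / 4 * t₀ := by nlinarith
      have h2 : K * (t + t ^ 2 / 4) ≤ K * (5 / 4 * t₀) := by gcongr
      have h3 : 0 ≤ a ^ 2 * t ^ 4 / (2 * δ ^ 2) := by positivity
      nlinarith
    · have h1 := ha h
      have h2 : (t + t ^ 2 / 4) * t₀ ^ 3 ≤ 2 * t ^ 4 := by
        have e1 : t * t₀ ^ 3 ≤ t * t ^ 3 := by gcongr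
        have e2 : t ^ 2 * t₀ ^ 2 ≤ t ^ 2 * t ^ 2 := by gcongr
        have e3 : t ^ 2 * t₀ ^ 3 ≤ t ^ 2 * t₀ ^ 2 := by
          exact mul_le_mul_of_nonneg_left (pow_le_pow_of_le_one ht₀.le ht₀1 (by norm_num))
            (by positivity)
        nlinarith [pow_pos ht 4]
      have h3 : K * (t + t ^ 2 / 4) ≤ a ^ 2 * t ^ 4 / (2 * δ ^ 2) := by
        rw [le_div_iff₀ (by positivity)]
        have h5 : c * t₀ ^ 3 ≤ a ^ 2 * t₀ ^ 3 := by gcongr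
        have h6 : K * (t + t ^ 2 / 4) * (2 * δ ^ 2) * t₀ ^ 3 ≤ a ^ 2 * t ^ 4 * t₀ ^ 3 := by
          calc K * (t + t ^ 2 / 4) * (2 * δ ^ 2) * t₀ ^ 3
              = 2 * K * δ ^ 2 * ((t + t ^ 2 / 4) * t₀ ^ 3) := by ring
            _ ≤ 2 * K * δ ^ 2 * (2 * t ^ 4) := by gcongr
            _ = 4 * K * δ ^ 2 * t ^ 4 := by ring
            _ ≤ a ^ 2 * t₀ ^ 3 * t ^ 4 :=
              mul_le_mul_of_nonneg_right (hc.trans h5) (by positivity)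
            _ = _ := by ring
        exact le_of_mul_le_mul_right h6 (by positivity)
      linarith
  have hv' : v * w * t ^ 2 / δ ≤ K * (t + t ^ 2 / 4) := by
    have : w * t ^ 2 / δ = t + t ^ 2 / 4 := by rw [hw]; field_simp; ring
    calc v * w * t ^ 2 / δ = v * (w * t ^ 2 / δ) := by ring
      _ ≤ K * (w * t ^ 2 / δ) := by gcongr
      _ = _ := by rw [this]
  -- Substituting `w = δ / 4 + δ / t` cancels the terms in `a ^ 2 * t ^ 2`.
  have hid : 2 * a * (t ^ 2 * (a / δ)) +
      w * ((t ^ 4 - 2 * t ^ 3) * (a / δ) * (a / δ) + t ^ 2 * (-(v * w) / δ)) + μ * w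
      = w * (a ^ 2 * t ^ 4 / (2 * δ ^ 2) - v * w * t ^ 2 / δ + μ) + a ^ 2 * t ^ 4 / (8 * δ) := by
    rw [hw]; field_simp; ring
  rw [hid]
  have h4 : 0 < a ^ 2 * t ^ 4 / (2 * δ ^ 2) - v * w * t ^ 2 / δ + μ := by linarith
  positivity

/-- The test function is `w * exp (-1 / r)` with `r = (w - δ / 4) / δ`, extended by zero where `r ≤
0` and outside the interval. Its pairing with a supersolution is nonpositive, yet the integrand is
nonnegative and positive on a nonempty open set. -/
theorem not_hasPositiveSupersolution {V w w₁ : ℝ → ℝ} {L K c w₀ μ : ℝ} (hL : 0 < L)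
    (hw : ContDiff ℝ ∞ w) (hw1 : ∀ x, HasDerivAt w (w₁ x) x)
    (hw2 : ∀ x ∈ Ioo 0 L, HasDerivAt w₁ (-(V x * w x)) x) (hpos : ∀ x ∈ Ioo 0 L, 0 < w x)
    (h0 : w 0 = 0) (hwL : w L = 0) (hV : ContinuousOn V (Ioo 0 L)) (hK : 0 < K)
    (hVK : ∀ x ∈ Ioo 0 L, V x ≤ K) (hc : 0 < c) (hw₀ : 0 < w₀)
    (hslope : ∀ x ∈ Ioo 0 L, w x ≤ w₀ → c ≤ w₁ x ^ 2) (hμ : 0 < μ) :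
    ¬ HasPositiveSupersolution V (Ioo 0 L) μ := by
  rintro ⟨ψ, ψ₁, ψ₂, hψ, hd1, hd2, hψpos, hle⟩
  obtain ⟨t₀, ht₀, ht₀1, ht₀μ⟩ : ∃ t₀ : ℝ, 0 < t₀ ∧ t₀ ≤ 1 ∧ 2 * K * t₀ ≤ μ := by
    refine ⟨min 1 (μ / (2 * K)), by positivity, min_le_left _ _, ?_⟩
    have := min_le_right 1 (μ / (2 * K))
    rw [le_div_iff₀ (by positivity)] at this
    linarith
  have hmid : L / 2 ∈ Ioo 0 L := ⟨by linarith, by linarith⟩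
  -- The three bounds serve, in turn, the dominance of the `t ^ 4` term, the implication from `t >
  -- t₀` to `w ≤ w₀`, and the nontriviality of the test function at the midpoint.
  obtain ⟨δ, hδ, hδ1, hδ2, hδ3⟩ : ∃ δ : ℝ, 0 < δ ∧ 4 * K * δ ^ 2 < c * t₀ ^ 3 ∧
      δ / 4 + δ / t₀ < w₀ ∧ δ / 4 < w (L / 2) := by
    have a1 : ∀ᶠ δ : ℝ in nhds 0, 4 * K * δ ^ 2 < c * t₀ ^ 3 :=
      ((by fun_prop : Continuous fun δ : ℝ => 4 * K * δ ^ 2).tendsto' 0 0 (by simp)).eventually_lt_const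
        (by positivity)
    have a2 : ∀ᶠ δ : ℝ in nhds 0, δ / 4 + δ / t₀ < w₀ :=
      ((by fun_prop : Continuous fun δ : ℝ => δ / 4 + δ / t₀).tendsto' 0 0 (by simp)).eventually_lt_const
        hw₀
    have a3 : ∀ᶠ δ : ℝ in nhds 0, δ / 4 < w (L / 2) :=
      ((by fun_prop : Continuous fun δ : ℝ => δ / 4).tendsto' 0 0 (by simp)).eventually_lt_const
        (hpos _ hmid)
    have a4 : ∀ᶠ δ : ℝ in nhdsWithin 0 (Ioi 0), 0 < δ := self_mem_nhdsWithin
    obtain ⟨δ, h, h'⟩ := (a4.and (nhdsWithin_le_nhds (a1.and (a2.and a3)))).exists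
    exact ⟨δ, h, h'⟩
  set r : ℝ → ℝ := fun x => (w x - δ / 4) / δ with hr
  have hr1 : ∀ x, HasDerivAt r (w₁ x / δ) x := fun x => ((hw1 x).sub_const _).div_const δ
  set g : ℝ → ℝ := fun x => w x * expNegInvGlue (r x) with hg
  set g₁ : ℝ → ℝ := fun x => w₁ x * expNegInvGlue (r x) +
    w x * ((r x)⁻¹ ^ 2 * expNegInvGlue (r x) * (w₁ x / δ)) with hg₁
  have hdg : ∀ x, HasDerivAt g (g₁ x) x := fun x =>
    (hw1 x).mul ((hasDerivAt_expNegInvGlue _).comp x (hr1 x))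
  have hdg1 : ∀ x ∈ Ioo 0 L, HasDerivAt g₁
      (-(V x * w x) * expNegInvGlue (r x) +
        w₁ x * ((r x)⁻¹ ^ 2 * expNegInvGlue (r x) * (w₁ x / δ)) +
        (w₁ x * ((r x)⁻¹ ^ 2 * expNegInvGlue (r x) * (w₁ x / δ)) +
        w x * (((r x)⁻¹ ^ 4 - 2 * (r x)⁻¹ ^ 3) * expNegInvGlue (r x) * (w₁ x / δ) * (w₁ x / δ) +
          (r x)⁻¹ ^ 2 * expNegInvGlue (r x) * (-(V x * w x) / δ)))) x := fun x hx =>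
    ((hw2 x hx).mul ((hasDerivAt_expNegInvGlue _).comp x (hr1 x))).add
      ((hw1 x).mul (((hasDerivAt_inv_sq_mul_expNegInvGlue _).comp x (hr1 x)).mul
        ((hw2 x hx).div_const δ)))
  have hgcont : ContDiff ℝ ∞ g :=
    hw.mul ((expNegInvGlue.contDiff (n := ⊤)).comp ((hw.sub contDiff_const).div_const δ))
  -- As `w` vanishes at both ends, this compact set stays inside the open interval and carries the
  -- support of the test function.
  set S : Set ℝ := Icc 0 L ∩ {x | δ / 4 ≤ w x} with hS
  have hSclosed : IsClosed S := isClosed_Icc.inter (isClosed_le continuous_const hw.continuous)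
  have hScomp : IsCompact S := isCompact_Icc.inter_right
    (isClosed_le continuous_const hw.continuous)
  have hSsub : S ⊆ Ioo 0 L := by
    rintro x ⟨⟨hx0, hxL⟩, hx⟩
    have hx : δ / 4 ≤ w x := hx
    refine ⟨hx0.lt_of_ne ?_, hxL.lt_of_ne ?_⟩
    · rintro rfl; rw [h0] at hx; linarith
    · rintro rfl; rw [hwL] at hx; linarith
  set η : ℝ → ℝ := (Ioo 0 L).indicator g with hη
  have hηS : ∀ x ∉ S, η x = 0 := by
    intro x hx
    by_cases hxI : x ∈ Ioo 0 L
    · rw [hη, indicator_of_mem hxI]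
      have : w x < δ / 4 := by
        by_contra! h; exact hx ⟨Ioo_subset_Icc_self hxI, h⟩
      have : r x ≤ 0 := div_nonpos_of_nonpos_of_nonneg (by linarith) hδ.le
      simp only [hg, expNegInvGlue.zero_of_nonpos this, mul_zero]
    · rw [hη, indicator_of_notMem hxI]
  have hts : tsupport η ⊆ S := closure_minimal (fun x hx => by
    by_contra h; exact hx (hηS x h)) hSclosed
  have hηc : HasCompactSupport η := hScomp.of_isClosed_subset (isClosed_tsupport η) hts
  have heq : ∀ x ∈ Ioo 0 L, η =ᶠ[nhds x] g := fun x hx => by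
    filter_upwards [isOpen_Ioo.mem_nhds hx] with y hy
    rw [hη, indicator_of_mem hy]
  have hηsmooth : ContDiff ℝ ∞ η := contDiff_iff_contDiffAt.2 fun x => by
    by_cases hx : x ∈ Ioo 0 L
    · exact hgcont.contDiffAt.congr_of_eventuallyEq (heq x hx)
    · refine (contDiffAt_const (c := (0 : ℝ))).congr_of_eventuallyEq ?_
      filter_upwards [hSclosed.isOpen_compl.mem_nhds fun h => hx (hSsub h)] with y hy
      exact hηS y hy
  have hη0 : ∀ x, 0 ≤ η x := indicator_nonneg fun x hx =>
    mul_nonneg (hpos x hx).le (expNegInvGlue.nonneg _)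
  obtain ⟨hint, hnonpos⟩ := setIntegral_supersolution_nonpos isOpen_Ioo hV hψ hd1 hd2 hle
    hηsmooth hηc (hts.trans hSsub) hη0
  have hη2 : ∀ x ∈ Ioo 0 L, deriv (deriv η) x + (V x + μ) * η x = expNegInvGlue (r x) *
      (2 * w₁ x * ((r x)⁻¹ ^ 2 * (w₁ x / δ)) +
      w x * (((r x)⁻¹ ^ 4 - 2 * (r x)⁻¹ ^ 3) * (w₁ x / δ) * (w₁ x / δ) +
        (r x)⁻¹ ^ 2 * (-(V x * w x) / δ)) + μ * w x) := by
    intro x hx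
    have e1 : deriv η =ᶠ[nhds x] g₁ := by
      filter_upwards [isOpen_Ioo.mem_nhds hx] with y hy
      rw [(heq y hy).deriv_eq, (hdg y).deriv]
    rw [e1.deriv_eq, (hdg1 x hx).deriv, (heq x hx).eq_of_nhds]
    simp only [hg]; ring
  have hfactor : ∀ x ∈ Ioo 0 L, 0 < r x → 0 <
      (2 * w₁ x * ((r x)⁻¹ ^ 2 * (w₁ x / δ)) +
      w x * (((r x)⁻¹ ^ 4 - 2 * (r x)⁻¹ ^ 3) * (w₁ x / δ) * (w₁ x / δ) +
        (r x)⁻¹ ^ 2 * (-(V x * w x) / δ)) + μ * w x) := by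
    intro x hx hrx
    have hwx : w x = δ / 4 + δ / (r x)⁻¹ := by
      simp only [hr]; field_simp; ring
    refine truncation_pos hK hδ ht₀ ht₀1 ht₀μ (inv_pos.2 hrx) hwx (hVK x hx) (fun ht => ?_) hδ1.le
    refine hslope x hx ?_
    have : δ / (r x)⁻¹ ≤ δ / t₀ := div_le_div_of_nonneg_left hδ.le ht₀ ht.le
    linarith
  have hFpos : ∀ x ∈ Ioo 0 L, 0 < r x →
      0 < ψ x * (deriv (deriv η) x + (V x + μ) * η x) := fun x hx hrx => by
    rw [hη2 x hx]
    exact mul_pos (hψpos x hx) (mul_pos (expNegInvGlue.pos_of_pos hrx) (hfactor x hx hrx))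
  have hF0 : ∀ x ∈ Ioo 0 L, 0 ≤ ψ x * (deriv (deriv η) x + (V x + μ) * η x) := fun x hx => by
    rcases le_or_gt (r x) 0 with h | h
    · rw [hη2 x hx, expNegInvGlue.zero_of_nonpos h]; simp
    · exact (hFpos x hx h).le
  have hF0' : 0 ≤ᵐ[volume.restrict (Ioo 0 L)]
      fun x => ψ x * (deriv (deriv η) x + (V x + μ) * η x) := by
    filter_upwards [ae_restrict_mem measurableSet_Ioo] with x hx using hF0 x hx
  have hzero := (setIntegral_eq_zero_iff_of_nonneg_ae hF0' hint).1
    (le_antisymm hnonpos (setIntegral_nonneg measurableSet_Ioo hF0))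
  rw [Filter.EventuallyEq, ae_restrict_iff' measurableSet_Ioo] at hzero
  have hOopen : IsOpen (Ioo 0 L ∩ {x | δ / 4 < w x}) :=
    isOpen_Ioo.inter (isOpen_lt continuous_const hw.continuous)
  refine (hOopen.measure_pos volume ⟨L / 2, hmid, hδ3⟩).ne' (measure_mono_null ?_ (ae_iff.1 hzero))
  rintro x ⟨hx, hxw⟩ h
  exact (hFpos x hx (div_pos (sub_pos.2 hxw) hδ)).ne' (h hx)

theorem principalEigenvalue_profile :
    principalEigenvalue (fun x => derivWithin reaction (Ici 0) (profile x))
      (Ioo 0 (11 / 20 * Real.pi)) = 0 := by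
  have hcont : Continuous fun x => baseSlope (Real.sin (angle x)) := by
    have hs : Continuous fun x => Real.sin (angle x) :=
      Real.continuous_sin.comp contDiff_angle.continuous
    have h1 : Continuous fun x => displacement₁ (Real.sin (angle x)) :=
      (contDiff_displacement₁ (n := 0)).continuous.comp hs
    have h2 : Continuous fun x => displacement₂ (Real.sin (angle x)) := by
      unfold displacement₂; fun_prop
    exact (h1.sub (hs.mul h2)).div (h1.pow 3) fun x => (pow_pos (displacement₁_pos _) 3).ne'
  refine le_antisymm (sSup_le ?_) (le_sSup ⟨0, ?_, rfl⟩)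
  · rintro _ ⟨μ, hμ, rfl⟩
    rw [← EReal.coe_zero, EReal.coe_le_coe_iff]
    by_contra! h
    refine not_hasPositiveSupersolution (K := 1250) (c := 3 / 100) (w₀ := 1 / 10)
      (by positivity) contDiff_kernelFun hasDerivAt_kernelFun (fun x hx => ?_)
      (fun x hx => kernelFun_pos hx) kernelFun_zero kernelFun_end
      (hcont.continuousOn.congr fun x hx => derivWithin_reaction_profile hx) (by norm_num)
      (fun x hx => ?_) (by norm_num) (by norm_num) (fun x hx => le_kernelFun₁_sq hx) h hμ
    · rw [derivWithin_reaction_profile hx]; exact hasDerivAt_kernelFun₁ x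
    · rw [derivWithin_reaction_profile hx]
      exact baseSlope_le (sin_angle_pos hx).le (Real.sin_le_one _)
  · refine hasPositiveSupersolution_zero measurableSet_Ioo hasDerivAt_kernelFun
      hasDerivAt_kernelFun₁ (hcont.mul contDiff_kernelFun.continuous).neg
      (fun x hx => kernelFun_pos hx) fun x hx => ?_
    rw [derivWithin_reaction_profile hx]; linarith

theorem mainTheorem9 :
    ∃ (f : ℝ → ℝ) (L : ℝ), IsWeakKPP f ∧ 0 < L ∧
      Real.pi ^ 2 / L ^ 2 < derivWithin f (Ici 0) 0 ∧
      ∃ φ : ℝ → ℝ, IsPositiveSolution f L φ ∧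
        (∀ u : ℝ → ℝ, IsPositiveSolution f L u → EqOn u φ (Icc 0 L)) ∧
        principalEigenvalue (fun x => derivWithin f (Ici 0) (φ x)) (Ioo 0 L) = 0 := by
  have hpi := Real.pi_pos
  refine ⟨reaction, 11 / 20 * Real.pi, isWeakKPP_reaction, by positivity, ?_, profile,
    isPositiveSolution_profile, fun u hu => hu.eqOn isPositiveSolution_profile,
    principalEigenvalue_profile⟩
  -- The claim amounts to `25 * (11/20)² = 121/16 > 1`.
  rw [derivWithin_reaction_zero, mul_pow, div_lt_iff₀ (by positivity)]
  nlinarith [pow_pos hpi 2]
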